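/- Let $\mathbb{T}=\mathbb{R}/2\pi\mathbb{Z}$ with normalized Lebesgue measure $\mu$, and let $X$ be a Banach function lattice on $\mathbb{T}$: a Banach space of (Lebesgue) measurable, complex-valued functions, defined and finite at every point, whose norm satisfies (inequalities and limits of functions being understood almost everywhere): (1) if $f$ is measurable, $g\in X$ and $|f|\le|g|$, then $f\in X$ and $\|f\|_X\le\|g\|_X$; (2) if $f_n\in X$, $\sup_n\|f_n\|_X<\infty$ and $0\le f_n\uparrow f$ with $f$ finite-valued, then $f\in X$ and $\|f_n\|_X\to\|f\|_X$; (3) for every measurable $E\subset\mathbb{T}$, $\chi_E\in X$ and $\int_E|f|\,d\mu\le c_E\|f\|_X$ for all $f\in X$, with a constant $c_E>0$. For $h>0$ put $A_hf(x)=\frac1h\int_{x-h/2}^{x+h/2}f(t)\,dt$. Assume that $A_hf\in X$ for all $f\in X$ and $h>0$, and that $\sup_{h>0,\ \|f\|_X\le1}\|A_hf\|_X<\infty$. Assume that the trigonometric polynomials are dense in $X$, and let $\mathcal{T}_n$ be the space of trigonometric polynomials of degree at most $n$. For each $n\ge1$ let $x_1,\dots,x_{m_n}$ ($m_n\ge 1$,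 $x_k=x_{k,n}$) be points such that, with $x_{m_n+1}=x_1+2\pi$, $$\frac{\gamma}{n}\le x_{k+1}-x_k\le\frac{\gamma'}{n},\qquad k=1,\dots,m_n,$$ where $\gamma,\gamma'>0$ do not depend on $n$ and $k$. Let $\varphi_{k,n}\in X$ and $$G_nf=\sum_{k=1}^{m_n}f(x_{k})\varphi_{k,n},\qquad \|f\|_{X_n}=\Big\|\sum_{k=1}^{m_n}|f(x_k)|\chi_{[x_k,x_{k+1})}\Big\|_X .$$ Fix $r,s\in\mathbb{N}=\{1,2,\dots\}$ and consider the following conditions, in which $K_1,K_2,K_3>0$ are independent of $n$, $f$ and $T$: - $(A_1)$ $\|G_nf\|_X\le K_1\|f\|_{X_n}$ for all $f\in X$, $n\ge1$; - $(A_2)$ $K_2\|f\|_{X_n}\le\|G_nf\|_X$ for all $f\in X$, $n\ge1$; - $(A_3)$ $\|T-G_nT\|_X\le K_3n^{-s}\|T^{(s)}\|_X$ for all $T\in\mathcal{T}_n$, $n\ge1$. Then for every bounded measurable function $f$ on $\mathbb{T}$: (i) if $(A_1)$, $(A_2)$ and $(A_3)$ hold, then $\|f-G_nf\|_X\to0$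 as $n\to\infty$ if and only if $\|(I-A_{\gamma/n})^rf\|_{X_n}\to0$ as $n\to\infty$; (ii) if $G_n$ maps into $\mathcal{T}_n$ for every $n\ge1$, and $(A_1)$ and $(A_3)$ hold, then $\|f-G_nf\|_X+\|f-G_nf\|_{X_n}\to0$ as $n\to\infty$ if and only if $\|(I-A_{\gamma/n})^rf\|_{X_n}\to0$ as $n\to\infty$. -/

import Mathlib

open MeasureTheory Filter Topology Set

noncomputable section

namespace SteklovSampling

instance fact_two_pi_pos : Fact (0 < 2 * Real.pi) := ⟨Real.two_pi_pos⟩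

/-- The circle `ℝ / 2πℤ`. A function on it is the same thing as a `2π`-periodic function on `ℝ`. -/
abbrev Circ : Type := AddCircle (2 * Real.pi)

/-- Lebesgue measure on the circle, normalized to total mass one. -/
abbrev μT : Measure Circ := AddCircle.haarAddCircle

/-- A Banach function lattice `X` on the circle. Its elements are honest functions
`Circ → ℂ`, defined and finite at every point and not identified when they agree almost everywhere,
while order and norm only see functions up to null sets. `AEMeasurable _ μT` says
Lebesgue measurable. The number `norm f` has a meaning only for `f ∈ carrier`.
(That `norm f = 0` exactly when `f = 0` a.e. follows from `ideal` and `integral_le`.) -/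
structure BanachFunctionLattice where
  /-- the linear space of functions -/
  carrier : Submodule ℂ (Circ → ℂ)
  /-- the norm of a member of the space -/
  norm : (Circ → ℂ) → ℝ
  aemeasurable : ∀ f ∈ carrier, AEMeasurable f μT
  norm_nonneg : ∀ f ∈ carrier, 0 ≤ norm f
  norm_smul : ∀ (c : ℂ), ∀ f ∈ carrier, norm (c • f) = ‖c‖ * norm f
  norm_add_le : ∀ f ∈ carrier, ∀ g ∈ carrier, norm (f + g) ≤ norm f + norm g
  /-- completeness -/
  complete : ∀ u : ℕ → Circ → ℂ, (∀ n, u n ∈ carrier) →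
    (∀ ε > 0, ∃ N, ∀ i ≥ N, ∀ j ≥ N, norm (u i - u j) < ε) →
    ∃ g ∈ carrier, Tendsto (fun n => norm (u n - g)) atTop (𝓝 0)
  /-- the lattice (ideal) property -/
  ideal : ∀ f g : Circ → ℂ, AEMeasurable f μT → g ∈ carrier → (∀ᵐ x ∂μT, ‖f x‖ ≤ ‖g x‖) →
    f ∈ carrier ∧ norm f ≤ norm g
  /-- the Fatou property -/
  fatou : ∀ (u : ℕ → Circ → ℝ) (f : Circ → ℝ), (∀ n, (fun x => (u n x : ℂ)) ∈ carrier) →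
    (∃ M : ℝ, ∀ n, norm (fun x => (u n x : ℂ)) ≤ M) →
    (∀ᵐ x ∂μT, (∀ n, 0 ≤ u n x) ∧ Monotone (fun n => u n x) ∧
      Tendsto (fun n => u n x) atTop (𝓝 (f x))) →
    (fun x => (f x : ℂ)) ∈ carrier ∧
      Tendsto (fun n => norm (fun x => (u n x : ℂ))) atTop (𝓝 (norm (fun x => (f x : ℂ))))
  /-- characteristic functions of measurable sets belong to the space -/
  indicator_mem : ∀ E : Set Circ, NullMeasurableSet E μT → E.indicator (fun _ => (1 : ℂ)) ∈ carrier
  /-- the norm controls the integral over a measurable set -/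
  integral_le : ∀ E : Set Circ, NullMeasurableSet E μT → ∃ c : ℝ, 0 < c ∧
    ∀ f ∈ carrier, IntegrableOn f E μT ∧ ∫ x in E, ‖f x‖ ∂μT ≤ c * norm f

/-- The Steklov average `A_h f (x) = (1/h) ∫_{x-h/2}^{x+h/2} f(t) dt`, written with the
integration variable centred at `x`. -/
def steklov (h : ℝ) (f : Circ → ℂ) (x : Circ) : ℂ :=
  (1 / h) • ∫ t in (-(h / 2))..(h / 2), f (x + (t : Circ))

/-- The operator `(I - A_h)^r`. -/
def steklovDiff (h : ℝ) (r : ℕ) : (Circ → ℂ) → (Circ → ℂ) :=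
  (fun f => f - steklov h f)^[r]

/-- The derivative of a function on the circle. -/
def circDeriv (f : Circ → ℂ) (x : Circ) : ℂ :=
  deriv (fun t : ℝ => f (x + (t : Circ))) 0

/-- `𝒯_n`: trigonometric polynomials of degree at most `n`, the span of
`x ↦ exp (i k x)`, `-n ≤ k ≤ n`. -/
def trigPoly (n : ℕ) : Submodule ℂ (Circ → ℂ) :=
  Submodule.span ℂ ((fun k : ℤ => (fourier k : Circ → ℂ)) '' Icc (-(n : ℤ)) n)

namespace BanachFunctionLattice

/-- The Steklov averages act on `X` and are uniformly bounded on it. -/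
def SteklovBounded (X : BanachFunctionLattice) : Prop :=
  ∃ C : ℝ, ∀ h : ℝ, 0 < h → ∀ f ∈ X.carrier,
    steklov h f ∈ X.carrier ∧ X.norm (steklov h f) ≤ C * X.norm f

/-- The trigonometric polynomials are dense in `X`. -/
def TrigDense (X : BanachFunctionLattice) : Prop :=
  ∀ f ∈ X.carrier, ∀ ε > 0, ∃ n : ℕ, ∃ T ∈ trigPoly n, X.norm (f - T) < ε

end BanachFunctionLattice

/-- The data of a sequence of sampling operators `G_n`, `n ≥ 1`, in `X`:
`count n ≥ 1` nodes and functions `phi n k ∈ X` for `k < count n`. The nodes are given by real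
representatives `node n 0, …, node n (count n - 1)`, continued by
`node n (count n) = node n 0 + 2π`. -/
structure SamplingScheme (X : BanachFunctionLattice) where
  /-- the number of nodes -/
  count : ℕ → ℕ
  /-- the nodes -/
  node : ℕ → ℕ → ℝ
  /-- the reconstruction functions -/
  phi : ℕ → ℕ → Circ → ℂ
  count_pos : ∀ n, 1 ≤ n → 1 ≤ count n
  node_last : ∀ n, 1 ≤ n → node n (count n) = node n 0 + 2 * Real.pi
  phi_mem : ∀ n, 1 ≤ n → ∀ k < count n, phi n k ∈ X.carrier

namespace SamplingScheme

variable {X : BanachFunctionLattice} (G : SamplingScheme X)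

/-- Consecutive nodes have distance between `γ / n` and `γ' / n`. -/
def Spacing (γ γ' : ℝ) : Prop :=
  ∀ n, 1 ≤ n → ∀ k < G.count n,
    γ / n ≤ G.node n (k + 1) - G.node n k ∧ G.node n (k + 1) - G.node n k ≤ γ' / n

/-- `G_n f = ∑_k f(x_k) φ_k`. -/
def op (n : ℕ) (f : Circ → ℂ) : Circ → ℂ :=
  fun x => ∑ k ∈ Finset.range (G.count n), f (G.node n k : Circ) * G.phi n k x

/-- The arc `[x_k, x_{k+1})` of the circle. -/
def arc (n k : ℕ) : Set Circ :=
  (fun t : ℝ => (t : Circ)) '' Ico (G.node n k) (G.node n (k + 1))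

/-- The discrete semi-norm `‖f‖_{X_n} = ‖∑_k |f(x_k)| χ_{[x_k, x_{k+1})}‖_X`. -/
def discNorm (n : ℕ) (f : Circ → ℂ) : ℝ :=
  X.norm fun x => ∑ k ∈ Finset.range (G.count n),
    (G.arc n k).indicator (fun _ => ((‖f (G.node n k : Circ)‖ : ℝ) : ℂ)) x

/-- `‖G_n f‖_X ≤ K₁ ‖f‖_{X_n}`. -/
def A1 : Prop :=
  ∃ K₁ : ℝ, 0 < K₁ ∧ ∀ n, 1 ≤ n → ∀ f ∈ X.carrier, X.norm (G.op n f) ≤ K₁ * G.discNorm n f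

/-- `K₂ ‖f‖_{X_n} ≤ ‖G_n f‖_X`. -/
def A2 : Prop :=
  ∃ K₂ : ℝ, 0 < K₂ ∧ ∀ n, 1 ≤ n → ∀ f ∈ X.carrier, K₂ * G.discNorm n f ≤ X.norm (G.op n f)

/-- `‖T - G_n T‖_X ≤ K₃ n^{-s} ‖T^{(s)}‖_X` for trigonometric polynomials `T` of degree at
most `n`. -/
def A3 (s : ℕ) : Prop :=
  ∃ K₃ : ℝ, 0 < K₃ ∧ ∀ n, 1 ≤ n → ∀ T ∈ trigPoly n,
    X.norm (T - G.op n T) ≤ K₃ * ((n : ℝ) ^ s)⁻¹ * X.norm (circDeriv^[s] T)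

/-- Every `G_n` takes its values in `𝒯_n`. -/
def MapsToTrig : Prop :=
  ∀ n, 1 ≤ n → ∀ f ∈ X.carrier, G.op n f ∈ trigPoly n

end SamplingScheme

end SteklovSampling

end

/-! Write `D_n` for `(I - A_{γ/n})^r` and `B_n = I - D_n`. A sample `f(x_k)` is not controlled by
the norm of `X`, but a sample of a Steklov average is: the window of width `γ/n` around `x_k` lies
in a window of comparable width around any point of the arc starting at `x_k`. Hence `B_n` is
bounded from `X` to `X_n`, uniformly in `n` (`exists_discNorm_sub_steklovDiff_le`). For a fixed
trigonometric polynomial `T`, `(A_3)` gives `G_n T → T`, and `D_n T → 0` uniformly. With `(A_1)` and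
density, `G_n B_n f → f` in `X` for every `f` in `X` (`tendsto_norm_sub_op_smooth`).

Since `f - G_n f = (f - G_n B_n f) - G_n D_n f`, convergence of `G_n f` to `f` amounts to `G_n D_n f
→ 0` in `X`. Under `(A_1)` and `(A_2)` this is `D_n f → 0` in `X_n`, which proves (i).

For (ii), the identity `f - G_n f = (B_n f - G_n f) + D_n f` is read in `X_n`. If `G_n f → f` in
`X`, then `B_n f - G_n f → 0` in `X_n`: a polynomial `T` close to `f` is inserted, and `T - G_n f`,
being of degree at most `n`, is handled by a Marcinkiewicz–Zygmund inequality
(`exists_discNorm_trigPoly_le`). That inequality follows from a reproducing kernel with quadratic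
decay, majorized by dyadic windows, so that only the boundedness of Steklov averages on `X` is
needed. -/

namespace SteklovSampling

/-! ### Elementary properties of the lattice norm. -/

namespace BanachFunctionLattice

variable (X : BanachFunctionLattice) {f g : Circ → ℂ}

protected lemma norm_zero : X.norm 0 = 0 := by
  simpa using X.norm_smul 0 0 X.carrier.zero_mem

protected lemma norm_neg (hf : f ∈ X.carrier) : X.norm (-f) = X.norm f := by
  simpa using X.norm_smul (-1) f hf

protected lemma norm_sub_le (hf : f ∈ X.carrier) (hg : g ∈ X.carrier) :
    X.norm (f - g) ≤ X.norm f + X.norm g := by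
  rw [sub_eq_add_neg, ← X.norm_neg hg]
  exact X.norm_add_le f hf _ (X.carrier.neg_mem hg)

lemma one_mem : (1 : Circ → ℂ) ∈ X.carrier := by
  have := X.indicator_mem univ MeasurableSet.univ.nullMeasurableSet
  rwa [indicator_univ] at this

lemma mem_and_norm_le_of_bound (hf : AEMeasurable f μT) {C : ℝ} (h : ∀ x, ‖f x‖ ≤ C) :
    f ∈ X.carrier ∧ X.norm f ≤ C * X.norm 1 := by
  have hC : 0 ≤ C := (_root_.norm_nonneg _).trans (h 0)
  obtain ⟨h1, h2⟩ := X.ideal f ((C : ℂ) • 1) hf (X.carrier.smul_mem _ X.one_mem)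
    (Eventually.of_forall fun x => by simpa [abs_of_nonneg hC] using h x)
  refine ⟨h1, h2.trans_eq ?_⟩
  rw [X.norm_smul _ _ X.one_mem]
  simp [abs_of_nonneg hC]

lemma abs_mem_and_norm_le (hf : f ∈ X.carrier) :
    (fun x => (‖f x‖ : ℂ)) ∈ X.carrier ∧ X.norm (fun x => (‖f x‖ : ℂ)) ≤ X.norm f :=
  X.ideal _ f (Complex.measurable_ofReal.comp_aemeasurable (X.aemeasurable f hf).norm) hf
    (Eventually.of_forall fun x => by simp)

lemma integrable_and_integral_le : ∃ c : ℝ, 0 < c ∧ ∀ f ∈ X.carrier,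
    Integrable f μT ∧ ∫ x, ‖f x‖ ∂μT ≤ c * X.norm f := by
  simpa using X.integral_le univ MeasurableSet.univ.nullMeasurableSet

protected lemma integrable (hf : f ∈ X.carrier) : Integrable f μT := by
  obtain ⟨c, -, h⟩ := X.integrable_and_integral_le
  exact (h f hf).1

end BanachFunctionLattice

/-! ### Comparison of Steklov averages with different centres. -/

lemma intervalIntegrable_translate {E : Type*} [NormedAddCommGroup E] {f : Circ → E}
    (hf : Integrable f μT) (x : Circ) (a b : ℝ) :
    IntervalIntegrable (fun t : ℝ => f (x + (t : Circ))) volume a b := by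
  have h1 : Integrable (fun y => f (x + y)) μT := hf.comp_add_left x
  have h2 : Integrable (fun y => f (x + y)) volume := by
    rw [AddCircle.volume_eq_smul_haarAddCircle]
    exact h1.smul_measure ENNReal.ofReal_ne_top
  have h3 := (AddCircle.measurePreserving_mk (2 * Real.pi) 0).integrable_comp_of_integrable h2
  have h4 : IntervalIntegrable (fun t : ℝ => f (x + (t : Circ))) volume 0 (0 + 2 * Real.pi) := by
    rw [intervalIntegrable_iff_integrableOn_Ioc_of_le (by linarith [Real.two_pi_pos])]
    exact h3
  refine Function.Periodic.intervalIntegrable (T := 2 * Real.pi) (fun t => ?_)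
    Real.two_pi_pos.ne' h4 a b
  simp

/-- The shifted window `[δ - a, δ + a]` lies in `[-H/2, H/2]` and `u` is nonnegative. Windows longer
than a period are allowed. -/
lemma integral_translate_le {u : Circ → ℝ} (hu : Integrable u μT) (hu0 : ∀ x, 0 ≤ u x) (x : Circ)
    {δ a H : ℝ} (ha : 0 ≤ a) (hH : a + |δ| ≤ H / 2) :
    ∫ t in (-a)..a, u (x + (δ : Circ) + (t : Circ)) ≤
      ∫ t in (-(H / 2))..(H / 2), u (x + (t : Circ)) := by
  have h1 := intervalIntegral.integral_comp_add_left (a := -a) (b := a)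
    (fun t : ℝ => u (x + (t : Circ))) δ
  simp only [AddCircle.coe_add, ← add_assoc] at h1
  rw [h1]
  obtain ⟨h2, h3⟩ := abs_le.1 (show |δ| ≤ H / 2 - a by linarith)
  exact intervalIntegral.integral_mono_interval (by linarith) (by linarith) (by linarith)
    (Eventually.of_forall fun t => hu0 _) (intervalIntegrable_translate hu _ _ _)

lemma norm_steklov_abs (f : Circ → ℂ) {H : ℝ} (hH : 0 < H) (x : Circ) :
    ‖steklov H (fun y => (‖f y‖ : ℂ)) x‖ =
      (1 / H) * ∫ t in (-(H / 2))..(H / 2), ‖f (x + (t : Circ))‖ := by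
  have h0 : 0 ≤ ∫ t in (-(H / 2))..(H / 2), ‖f (x + (t : Circ))‖ :=
    intervalIntegral.integral_nonneg (by linarith) fun _ _ => norm_nonneg _
  rw [steklov, intervalIntegral.integral_ofReal, norm_smul, Complex.norm_real,
    Real.norm_of_nonneg h0, Real.norm_of_nonneg (by positivity)]

/-- This lets the value at a node be bounded by a function evaluated at an arbitrary nearby point.
The price is the ratio of the window lengths. -/
lemma norm_steklov_translate_le {f : Circ → ℂ} (hf : Integrable f μT) (x : Circ) {δ h H : ℝ}
    (hh : 0 < h) (hH : h / 2 + |δ| ≤ H / 2) :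
    ‖steklov h f (x + (δ : Circ))‖ ≤ (H / h) * ‖steklov H (fun y => (‖f y‖ : ℂ)) x‖ := by
  have hH0 : 0 < H := by linarith [abs_nonneg δ]
  rw [norm_steklov_abs f hH0, steklov, norm_smul, Real.norm_of_nonneg (by positivity)]
  have h1 := integral_translate_le hf.norm (fun _ => norm_nonneg _) x (by linarith) hH
  have h2 : ‖∫ t in (-(h / 2))..(h / 2), f (x + (δ : Circ) + (t : Circ))‖ ≤ _ :=
    (intervalIntegral.norm_integral_le_integral_norm (by linarith)).trans h1
  calc _ ≤ 1 / h * ∫ t in (-(H / 2))..(H / 2), ‖f (x + (t : Circ))‖ := by gcongr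
    _ = _ := by field_simp

/-! ### Arcs and the discrete semi-norm. -/

namespace SamplingScheme

variable {X : BanachFunctionLattice} (G : SamplingScheme X) {γ γ' : ℝ} {n : ℕ} {f g : Circ → ℂ}

/-- The step function whose norm is `discNorm`. -/
noncomputable def stepFun (n : ℕ) (f : Circ → ℂ) : Circ → ℂ :=
  fun x => ∑ k ∈ Finset.range (G.count n),
    (G.arc n k).indicator (fun _ => ((‖f (G.node n k : Circ)‖ : ℝ) : ℂ)) x

variable {G}

lemma Spacing.node_lt (hG : G.Spacing γ γ') (hγ : 0 < γ) (hn : 1 ≤ n) {k : ℕ}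
    (hk : k < G.count n) : G.node n k < G.node n (k + 1) := by
  have h1 := (hG n hn k hk).1
  have h2 : 0 < γ / n := by positivity
  linarith

lemma Spacing.node_mono (hG : G.Spacing γ γ') (hγ : 0 < γ) (hn : 1 ≤ n) {i j : ℕ}
    (hij : i ≤ j) (hj : j ≤ G.count n) : G.node n i ≤ G.node n j := by
  induction j, hij using Nat.le_induction with
  | base => exact le_rfl
  | succ j hij ih => exact (ih (by omega)).trans (hG.node_lt hγ hn hj).le

/-- All the intervals lie in one period `[x_0, x_0 + 2π)`, on which the projection to the circle is
injective, so disjointness is inherited from the line. -/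
lemma Spacing.arc_disjoint (hG : G.Spacing γ γ') (hγ : 0 < γ) (hn : 1 ≤ n) {i j : ℕ}
    (hi : i < G.count n) (hj : j < G.count n) {x : Circ} (hxi : x ∈ G.arc n i)
    (hxj : x ∈ G.arc n j) : i = j := by
  obtain ⟨t, ht, rfl⟩ := hxi
  obtain ⟨t', ht', h⟩ := hxj
  have key : ∀ k < G.count n, ∀ t ∈ Ico (G.node n k) (G.node n (k + 1)),
      t ∈ Ico (G.node n 0) (G.node n 0 + 2 * Real.pi) := fun k hk t ht =>
    ⟨(hG.node_mono hγ hn (Nat.zero_le k) hk.le).trans ht.1,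
      ht.2.trans_le ((hG.node_mono hγ hn hk le_rfl).trans_eq (G.node_last n hn))⟩
  have h' := (AddCircle.coe_eq_coe_iff_of_mem_Ico (key j hj _ ht') (key i hi _ ht)).1 h
  subst h'
  rcases lt_trichotomy i j with hlt | heq | hlt
  · linarith [hG.node_mono hγ hn hlt hj.le, ht.2, ht'.1]
  · exact heq
  · linarith [hG.node_mono hγ hn hlt hi.le, ht'.2, ht.1]

lemma Spacing.measurableSet_arc (hG : G.Spacing γ γ') (hγ : 0 < γ) (hn : 1 ≤ n) {k : ℕ}
    (hk : k < G.count n) : MeasurableSet (G.arc n k) := by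
  have ho : IsOpen ((fun t : ℝ => (t : Circ)) '' Ioo (G.node n k) (G.node n (k + 1))) :=
    QuotientAddGroup.isOpenMap_coe _ isOpen_Ioo
  rw [arc, ← Ioo_insert_left (hG.node_lt hγ hn hk), image_insert_eq]
  exact ho.measurableSet.insert _

lemma Spacing.stepFun_mem (hG : G.Spacing γ γ') (hγ : 0 < γ) (hn : 1 ≤ n) (f : Circ → ℂ) :
    G.stepFun n f ∈ X.carrier := by
  have : G.stepFun n f = ∑ k ∈ Finset.range (G.count n),
      (‖f (G.node n k : Circ)‖ : ℂ) • (G.arc n k).indicator (fun _ => (1 : ℂ)) := by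
    ext x
    simp only [stepFun, Finset.sum_apply, Pi.smul_apply, smul_eq_mul]
    refine Finset.sum_congr rfl fun k _ => ?_
    by_cases hx : x ∈ G.arc n k <;> simp [hx]
  rw [this]
  exact X.carrier.sum_mem fun k hk => X.carrier.smul_mem _ (X.indicator_mem _
    (hG.measurableSet_arc hγ hn (Finset.mem_range.1 hk)).nullMeasurableSet)

lemma Spacing.stepFun_apply (hG : G.Spacing γ γ') (hγ : 0 < γ) (hn : 1 ≤ n) {k : ℕ}
    (hk : k < G.count n) {x : Circ} (hx : x ∈ G.arc n k) :
    G.stepFun n f x = (‖f (G.node n k : Circ)‖ : ℂ) := by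
  rw [stepFun, Finset.sum_eq_single_of_mem k (Finset.mem_range.2 hk), indicator_of_mem hx]
  exact fun j hj hjk => indicator_of_notMem
    (fun hxj => hjk (hG.arc_disjoint hγ hn (Finset.mem_range.1 hj) hk hxj hx)) _

lemma Spacing.discNorm_nonneg (hG : G.Spacing γ γ') (hγ : 0 < γ) (hn : 1 ≤ n) (f : Circ → ℂ) :
    0 ≤ G.discNorm n f := X.norm_nonneg _ (hG.stepFun_mem hγ hn f)

/-- By disjointness the step function equals `|f(x_k)|` on the `k`-th arc, and it vanishes off the
arcs, so the ideal property applies without knowing that the arcs cover the circle. -/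
lemma Spacing.discNorm_le (hG : G.Spacing γ γ') (hγ : 0 < γ) (hn : 1 ≤ n) {v : Circ → ℂ}
    (hv : v ∈ X.carrier)
    (h : ∀ k < G.count n, ∀ x ∈ G.arc n k, ‖f (G.node n k : Circ)‖ ≤ ‖v x‖) :
    G.discNorm n f ≤ X.norm v := by
  refine (X.ideal _ v (X.aemeasurable _ (hG.stepFun_mem hγ hn f)) hv
    (Eventually.of_forall fun x => ?_)).2
  by_cases hx : ∃ k < G.count n, x ∈ G.arc n k
  · obtain ⟨k, hk, hxk⟩ := hx
    rw [hG.stepFun_apply hγ hn hk hxk]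
    simpa using h k hk x hxk
  · push Not at hx
    rw [stepFun, Finset.sum_eq_zero fun k hk => indicator_of_notMem (hx k (Finset.mem_range.1 hk)) _]
    simp

lemma Spacing.discNorm_add_le (hG : G.Spacing γ γ') (hγ : 0 < γ) (hn : 1 ≤ n)
    (f g : Circ → ℂ) : G.discNorm n (f + g) ≤ G.discNorm n f + G.discNorm n g := by
  have hf := hG.stepFun_mem hγ hn f
  have hg := hG.stepFun_mem hγ hn g
  refine (hG.discNorm_le hγ hn (X.carrier.add_mem hf hg) fun k hk x hx => ?_).trans
    (X.norm_add_le _ hf _ hg)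
  rw [Pi.add_apply, Pi.add_apply, hG.stepFun_apply hγ hn hk hx, hG.stepFun_apply hγ hn hk hx,
    ← Complex.ofReal_add, Complex.norm_real, Real.norm_of_nonneg (by positivity)]
  exact norm_add_le _ _

lemma discNorm_neg (f : Circ → ℂ) : G.discNorm n (-f) = G.discNorm n f := by
  simp [discNorm]

lemma Spacing.discNorm_sub_le (hG : G.Spacing γ γ') (hγ : 0 < γ) (hn : 1 ≤ n)
    (f g : Circ → ℂ) : G.discNorm n (f - g) ≤ G.discNorm n f + G.discNorm n g := by
  rw [sub_eq_add_neg, ← discNorm_neg (G := G) g]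
  exact hG.discNorm_add_le hγ hn _ _

lemma Spacing.discNorm_le_of_bound (hG : G.Spacing γ γ') (hγ : 0 < γ) (hn : 1 ≤ n) {C : ℝ}
    (h : ∀ x, ‖f x‖ ≤ C) : G.discNorm n f ≤ C * X.norm 1 := by
  have hC : 0 ≤ C := (norm_nonneg _).trans (h 0)
  have h1 : (fun _ => (C : ℂ) : Circ → ℂ) ∈ X.carrier ∧ X.norm (fun _ => (C : ℂ)) ≤ C * X.norm 1 :=
    X.mem_and_norm_le_of_bound aemeasurable_const fun _ => by simp [abs_of_nonneg hC]
  refine (hG.discNorm_le hγ hn h1.1 fun k _ x _ => ?_).trans h1.2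
  simpa [abs_of_nonneg hC] using h _

/-- A point of an arc differs from the node at its left end by at most `γ' / n`. -/
lemma Spacing.exists_node_eq (hG : G.Spacing γ γ') (hn : 1 ≤ n) {k : ℕ}
    (hk : k < G.count n) {x : Circ} (hx : x ∈ G.arc n k) :
    ∃ δ : ℝ, |δ| ≤ γ' / n ∧ (G.node n k : Circ) = x + (δ : Circ) := by
  obtain ⟨t, ht, rfl⟩ := hx
  refine ⟨G.node n k - t, ?_, ?_⟩
  · rw [abs_le]
    constructor <;> linarith [ht.1, ht.2, (hG n hn k hk).2]
  · simp

lemma Spacing.exists_discNorm_steklov_le (hG : G.Spacing γ γ') (hγ : 0 < γ) (hγ' : 0 < γ')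
    (hA : X.SteklovBounded) : ∃ C : ℝ, 0 ≤ C ∧ ∀ n, 1 ≤ n → ∀ f ∈ X.carrier,
      G.discNorm n (steklov (γ / n) f) ≤ C * X.norm f := by
  obtain ⟨C, hC⟩ := hA
  refine ⟨(γ + 2 * γ') / γ * |C|, by positivity, fun n hn f hf => ?_⟩
  have hn0 : (0 : ℝ) < n := by positivity
  -- Half of this width is `γ/(2n) + γ'/n`: the half-window plus the largest distance from a point
  -- of an arc to its node. The ratio to `γ/n` does not depend on `n`.
  set H : ℝ := (γ + 2 * γ') / n with hH
  have hH0 : 0 < H := by positivity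
  obtain ⟨ha, ha'⟩ := X.abs_mem_and_norm_le hf
  obtain ⟨hs, hs'⟩ := hC H hH0 _ ha
  have hr : H / (γ / n) = (γ + 2 * γ') / γ := by rw [hH]; field_simp
  have hq : 0 ≤ (γ + 2 * γ') / γ := by positivity
  have h1 := hG.discNorm_le hγ hn (f := steklov (γ / n) f)
    (X.carrier.smul_mem (((γ + 2 * γ') / γ : ℝ) : ℂ) hs) (fun k hk x hx => by
      obtain ⟨δ, hδ, he⟩ := hG.exists_node_eq hn hk hx
      rw [he, Pi.smul_apply, norm_smul, Complex.norm_real, Real.norm_of_nonneg hq, ← hr]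
      refine norm_steklov_translate_le (X.integrable hf) x (by positivity) ?_
      have : H / 2 = γ / n / 2 + γ' / n := by rw [hH]; field_simp
      linarith)
  rw [X.norm_smul _ _ hs, Complex.norm_real, Real.norm_of_nonneg hq] at h1
  refine h1.trans ?_
  rw [mul_assoc]
  refine mul_le_mul_of_nonneg_left (hs'.trans ?_) hq
  exact mul_le_mul (le_abs_self C) ha' (X.norm_nonneg _ ha) (abs_nonneg C)

end SamplingScheme

/-! ### Steklov differences of bounded and continuous functions. -/

section Steklov

variable {f g : Circ → ℂ} {h : ℝ}

lemma steklov_sub (hf : Integrable f μT) (hg : Integrable g μT) :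
    steklov h (f - g) = steklov h f - steklov h g := by
  ext x
  simp only [steklov, Pi.sub_apply]
  rw [intervalIntegral.integral_sub (intervalIntegrable_translate hf _ _ _)
    (intervalIntegrable_translate hg _ _ _), smul_sub]

lemma steklovDiff_succ (r : ℕ) (f : Circ → ℂ) :
    steklovDiff h (r + 1) f = steklovDiff h r (f - steklov h f) := rfl

lemma norm_steklov_le_of_bound (hh : 0 < h) {C : ℝ} (hC : ∀ x, ‖f x‖ ≤ C) (x : Circ) :
    ‖steklov h f x‖ ≤ C := by
  rw [steklov, norm_smul, Real.norm_of_nonneg (by positivity)]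
  have := intervalIntegral.norm_integral_le_of_norm_le_const (a := -(h / 2)) (b := h / 2)
    (f := fun t : ℝ => f (x + (t : Circ))) (C := C) fun t _ => hC _
  rw [show |h / 2 - -(h / 2)| = h by rw [sub_neg_eq_add, add_halves, abs_of_pos hh]] at this
  calc _ ≤ 1 / h * (C * h) := by gcongr
    _ = C := by field_simp

lemma norm_steklovDiff_le_of_bound (hh : 0 < h) (r : ℕ) {C : ℝ} (hC : ∀ x, ‖f x‖ ≤ C)
    (x : Circ) : ‖steklovDiff h r f x‖ ≤ 2 ^ r * C := by
  induction r generalizing f C with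
  | zero => simpa [steklovDiff] using hC x
  | succ r ih =>
    rw [steklovDiff_succ, pow_succ, mul_assoc, two_mul C]
    exact ih fun y => (norm_sub_le _ _).trans
      (add_le_add (hC y) (norm_steklov_le_of_bound hh hC y))

lemma exists_norm_sub_steklov_le (hf : Continuous f) {ε : ℝ} (hε : 0 < ε) :
    ∃ δ > 0, ∀ h, 0 < h → h < δ → ∀ x, ‖(f - steklov h f) x‖ ≤ ε := by
  obtain ⟨δ, hδ, H⟩ := Metric.uniformContinuous_iff.1
    (CompactSpace.uniformContinuous_of_continuous hf) ε hε
  refine ⟨δ, hδ, fun h hh hhδ x => ?_⟩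
  have h1 : f x = (1 / h) • ∫ _ in (-(h / 2))..(h / 2), f x := by
    rw [intervalIntegral.integral_const, sub_neg_eq_add, add_halves, smul_smul,
      one_div_mul_cancel hh.ne', one_smul]
  have h2 : IntervalIntegrable (fun t : ℝ => f (x + (t : Circ))) volume (-(h / 2)) (h / 2) :=
    (hf.comp (continuous_const.add (AddCircle.continuous_mk' _))).intervalIntegrable _ _
  rw [Pi.sub_apply, h1, steklov, ← smul_sub,
    ← intervalIntegral.integral_sub intervalIntegrable_const h2, norm_smul,
    Real.norm_of_nonneg (by positivity)]
  have h3 := intervalIntegral.norm_integral_le_of_norm_le_const (a := -(h / 2)) (b := h / 2)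
    (f := fun t : ℝ => f x - f (x + (t : Circ))) (C := ε) fun t ht => by
      rw [uIoc_of_le (by linarith)] at ht
      have h4 : ‖(t : Circ)‖ ≤ |t| := QuotientAddGroup.norm_mk_le_norm
      have h5 : |t| ≤ h / 2 := abs_le.2 ⟨ht.1.le, ht.2⟩
      have := H (a := x) (b := x + (t : Circ)) (by
        rw [dist_eq_norm, sub_add_cancel_left, norm_neg]; linarith)
      rw [dist_eq_norm] at this
      exact this.le
  rw [show |h / 2 - -(h / 2)| = h by rw [sub_neg_eq_add, add_halves, abs_of_pos hh]] at h3
  calc _ ≤ 1 / h * (ε * h) := by gcongr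
    _ = ε := by field_simp

end Steklov

/-! ### Trigonometric polynomials as members of the lattice. -/

section TrigPoly

lemma trigPoly_mono {m n : ℕ} (h : m ≤ n) : trigPoly m ≤ trigPoly n :=
  Submodule.span_mono (image_mono (Icc_subset_Icc (by omega) (by omega)))

lemma continuous_of_mem_trigPoly {n : ℕ} {T : Circ → ℂ} (hT : T ∈ trigPoly n) :
    Continuous T := by
  induction hT using Submodule.span_induction with
  | mem T h => obtain ⟨k, -, rfl⟩ := h; exact (fourier k).continuous
  | zero => exact continuous_const
  | add f g _ _ hf hg => exact hf.add hg
  | smul c f _ hf => exact hf.const_smul c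

lemma exists_bound_of_continuous {T : Circ → ℂ} (hT : Continuous T) : ∃ C, ∀ x, ‖T x‖ ≤ C := by
  obtain ⟨C, hC⟩ := isCompact_univ.exists_bound_of_continuousOn hT.continuousOn
  exact ⟨C, fun x => hC x (mem_univ x)⟩

end TrigPoly

namespace BanachFunctionLattice

variable {X : BanachFunctionLattice} {f g : Circ → ℂ} {h : ℝ}

lemma mem_of_mem_trigPoly {n : ℕ} {T : Circ → ℂ} (hT : T ∈ trigPoly n) : T ∈ X.carrier := by
  have hc := continuous_of_mem_trigPoly hT
  obtain ⟨C, hC⟩ := exists_bound_of_continuous hc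
  exact (X.mem_and_norm_le_of_bound hc.measurable.aemeasurable hC).1

lemma SteklovBounded.steklovDiff_mem (hA : X.SteklovBounded) (hh : 0 < h) (r : ℕ)
    (hf : f ∈ X.carrier) : steklovDiff h r f ∈ X.carrier := by
  obtain ⟨C, hC⟩ := hA
  induction r generalizing f with
  | zero => exact hf
  | succ r ih => exact ih (X.carrier.sub_mem hf (hC h hh f hf).1)

lemma SteklovBounded.steklovDiff_sub (hA : X.SteklovBounded) (hh : 0 < h) (r : ℕ)
    (hf : f ∈ X.carrier) (hg : g ∈ X.carrier) :
    steklovDiff h r (f - g) = steklovDiff h r f - steklovDiff h r g := by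
  obtain ⟨C, hC⟩ := hA
  induction r generalizing f g with
  | zero => rfl
  | succ r ih =>
    rw [steklovDiff_succ, steklovDiff_succ, steklovDiff_succ,
      ← ih (X.carrier.sub_mem hf (hC h hh f hf).1) (X.carrier.sub_mem hg (hC h hh g hg).1),
      steklov_sub (X.integrable hf) (X.integrable hg)]
    congr 1
    abel

end BanachFunctionLattice

/-! ### Sampling of smoothed functions and the equivalence (i). -/

namespace SamplingScheme

variable {X : BanachFunctionLattice} {G : SamplingScheme X} {γ γ' : ℝ} {n : ℕ} {f g : Circ → ℂ}

lemma op_sub (f g : Circ → ℂ) : G.op n (f - g) = G.op n f - G.op n g := by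
  ext x
  simp [op, sub_mul]

lemma op_mem (hn : 1 ≤ n) (f : Circ → ℂ) : G.op n f ∈ X.carrier := by
  have : G.op n f = ∑ k ∈ Finset.range (G.count n), f (G.node n k : Circ) • G.phi n k := by
    ext x
    simp [op, Finset.sum_apply]
  rw [this]
  exact X.carrier.sum_mem fun k hk =>
    X.carrier.smul_mem _ (G.phi_mem n hn k (Finset.mem_range.1 hk))

/-- The operators `I - (I - A_{γ/n})^r` are bounded from `X` to the discrete semi-norms. -/
lemma Spacing.exists_discNorm_sub_steklovDiff_le (hG : G.Spacing γ γ') (hγ : 0 < γ)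
    (hγ' : 0 < γ') (hA : X.SteklovBounded) (r : ℕ) :
    ∃ C : ℝ, 0 ≤ C ∧ ∀ n : ℕ, 1 ≤ n → ∀ f ∈ X.carrier,
      G.discNorm n (f - steklovDiff (γ / n) r f) ≤ C * X.norm f := by
  obtain ⟨C₁, hC₁, H₁⟩ := hG.exists_discNorm_steklov_le hγ hγ' hA
  induction r with
  | zero =>
    refine ⟨0, le_rfl, fun n hn f hf => ?_⟩
    have := hG.discNorm_le_of_bound hγ hn (f := f - steklovDiff (γ / n) 0 f) (C := 0)
      fun x => by simp [steklovDiff]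
    simpa using this
  | succ r ih =>
    obtain ⟨C, hC, H⟩ := ih
    obtain ⟨C₂, H₂⟩ := hA
    refine ⟨C₁ + C * (1 + |C₂|), by positivity, fun n hn f hf => ?_⟩
    obtain ⟨hm, hm'⟩ := H₂ (γ / n) (by positivity) f hf
    have hd := X.carrier.sub_mem hf hm
    -- With `g = f - A f`, the identity is `f - (I - A)^(r+1) f = A f + (g - (I - A)^r g)`; no
    -- unaveraged sample of `f` survives.
    have e : f - steklovDiff (γ / n) (r + 1) f = steklov (γ / n) f +
        ((f - steklov (γ / n) f) - steklovDiff (γ / n) r (f - steklov (γ / n) f)) := by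
      rw [steklovDiff_succ]; abel
    rw [e]
    have h1 : X.norm (f - steklov (γ / n) f) ≤ (1 + |C₂|) * X.norm f := by
      have := X.norm_sub_le hf hm
      have := mul_le_mul_of_nonneg_right (le_abs_self C₂) (X.norm_nonneg f hf)
      linarith
    calc _ ≤ _ := hG.discNorm_add_le hγ hn _ _
      _ ≤ C₁ * X.norm f + C * ((1 + |C₂|) * X.norm f) :=
        add_le_add (H₁ n hn f hf) ((H n hn _ hd).trans (mul_le_mul_of_nonneg_left h1 hC))
      _ = _ := by ring

/-- One factor `I - A_h` makes `f` uniformly small by uniform continuity; the remaining factors cost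
at most 2 each in the sup norm. This is where `r ≥ 1` matters. -/
lemma Spacing.tendsto_discNorm_steklovDiff_of_continuous (hG : G.Spacing γ γ') (hγ : 0 < γ)
    {r : ℕ} (hr : 1 ≤ r) (hf : Continuous f) :
    Tendsto (fun n : ℕ => G.discNorm n (steklovDiff (γ / n) r f)) atTop (𝓝 0) := by
  obtain ⟨r, rfl⟩ := Nat.exists_eq_add_of_le' hr
  refine Metric.tendsto_atTop.2 fun ε hε => ?_
  have h1 : 0 ≤ X.norm 1 := X.norm_nonneg _ X.one_mem
  -- The summand 1 keeps the denominator positive and makes the final inequality strict, using only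
  -- `0 ≤ X.norm 1`.
  obtain ⟨δ, hδ, H⟩ := exists_norm_sub_steklov_le hf
    (ε := ε / (2 ^ r * (X.norm 1 + 1))) (by positivity)
  have h2 : ∀ᶠ n : ℕ in atTop, γ / n < δ :=
    (tendsto_const_div_atTop_nhds_zero_nat γ).eventually (gt_mem_nhds hδ)
  obtain ⟨N, hN⟩ := eventually_atTop.1 (h2.and (eventually_ge_atTop 1))
  refine ⟨N, fun n hn => ?_⟩
  obtain ⟨hn1, hn2⟩ := hN n hn
  have hh : 0 < γ / n := by positivity
  rw [Real.dist_0_eq_abs, abs_of_nonneg (hG.discNorm_nonneg hγ hn2 _)]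
  refine (hG.discNorm_le_of_bound hγ hn2
    (norm_steklovDiff_le_of_bound hh r (H _ hh hn1))).trans_lt ?_
  calc _ = ε * (X.norm 1 / (X.norm 1 + 1)) := by field_simp
    _ < ε * 1 := by
      gcongr
      rw [div_lt_one (by positivity)]
      linarith
    _ = ε := mul_one ε

lemma tendsto_norm_sub_op_of_mem_trigPoly {s m : ℕ} (h3 : G.A3 s) (hs : 1 ≤ s) {T : Circ → ℂ}
    (hT : T ∈ trigPoly m) : Tendsto (fun n : ℕ => X.norm (T - G.op n T)) atTop (𝓝 0) := by
  obtain ⟨K, hK, H⟩ := h3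
  have h1 : Tendsto (fun n : ℕ => K * ((n : ℝ) ^ s)⁻¹ * X.norm (circDeriv^[s] T)) atTop (𝓝 0) := by
    have h2 : Tendsto (fun n : ℕ => ((n : ℝ) ^ s)⁻¹) atTop (𝓝 0) :=
      ((tendsto_pow_atTop (by omega)).comp tendsto_natCast_atTop_atTop).inv_tendsto_atTop
    simpa using (h2.const_mul K).mul_const (X.norm (circDeriv^[s] T))
  refine tendsto_of_tendsto_of_tendsto_of_le_of_le' tendsto_const_nhds h1 ?_ ?_
  · filter_upwards [eventually_ge_atTop 1] with n hn
    exact X.norm_nonneg _ (X.carrier.sub_mem (X.mem_of_mem_trigPoly hT) (op_mem hn T))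
  · filter_upwards [eventually_ge_atTop 1, eventually_ge_atTop m] with n hn hm
    exact H n hn T (trigPoly_mono hm hT)

/-- Applied to the smoothed function `f - (I - A_{γ/n})^r f`, the sampling operators
converge to `f`. -/
lemma Spacing.tendsto_norm_sub_op_smooth (hG : G.Spacing γ γ') (hγ : 0 < γ) (hγ' : 0 < γ')
    (hA : X.SteklovBounded) (hdense : X.TrigDense) {r s : ℕ} (hr : 1 ≤ r) (hs : 1 ≤ s)
    (h1 : G.A1) (h3 : G.A3 s) (hf : f ∈ X.carrier) :
    Tendsto (fun n : ℕ => X.norm (f - G.op n (f - steklovDiff (γ / n) r f))) atTop (𝓝 0) := by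
  obtain ⟨K, hK, HK⟩ := h1
  obtain ⟨C, hC, HC⟩ := hG.exists_discNorm_sub_steklovDiff_le hγ hγ' hA r
  refine Metric.tendsto_atTop.2 fun ε hε => ?_
  obtain ⟨m, T, hT, hfT⟩ := hdense f hf (ε / (2 * (1 + K * C))) (by positivity)
  have hTX := X.mem_of_mem_trigPoly hT
  have l1 := tendsto_norm_sub_op_of_mem_trigPoly h3 hs hT
  have l2 := (hG.tendsto_discNorm_steklovDiff_of_continuous hγ hr
    (continuous_of_mem_trigPoly hT)).const_mul K
  have l3 := l1.add l2
  rw [mul_zero, add_zero] at l3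
  obtain ⟨N, hN⟩ := eventually_atTop.1
    ((l3.eventually (gt_mem_nhds (half_pos hε))).and (eventually_ge_atTop 1))
  refine ⟨N, fun n hn => ?_⟩
  obtain ⟨hn1, hn2⟩ := hN n hn
  have hh : 0 < γ / n := by positivity
  have hfT' := X.carrier.sub_mem hf hTX
  have hd := hA.steklovDiff_mem hh r hTX
  have hd' := hA.steklovDiff_mem hh r hfT'
  rw [Real.dist_0_eq_abs, abs_of_nonneg (X.norm_nonneg _ (X.carrier.sub_mem hf (op_mem hn2 _)))]
  -- The terms in `T` vanish in the limit; those in `f - T` contribute at most `(1 + K * C) * X.norm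
  -- (f - T)`, hence the choice of `T`.
  have e : f - G.op n (f - steklovDiff (γ / n) r f) = (f - T) + ((T - G.op n T) +
      (G.op n (steklovDiff (γ / n) r T) -
        G.op n ((f - T) - steklovDiff (γ / n) r (f - T)))) := by
    rw [hA.steklovDiff_sub hh r hf hTX]
    simp only [op_sub]
    abel
  have b1 := HK n hn2 _ hd
  have b2 := (HK n hn2 _ (X.carrier.sub_mem hfT' hd')).trans
    (mul_le_mul_of_nonneg_left (HC n hn2 _ hfT') hK.le)
  have b3 : X.norm (f - G.op n (f - steklovDiff (γ / n) r f)) ≤ X.norm (f - T) +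
      (X.norm (T - G.op n T) + (X.norm (G.op n (steklovDiff (γ / n) r T)) +
        X.norm (G.op n ((f - T) - steklovDiff (γ / n) r (f - T))))) := by
    rw [e]
    have m1 := X.carrier.sub_mem hTX (op_mem (G := G) hn2 T)
    have m2 := X.carrier.sub_mem (op_mem (G := G) hn2 (steklovDiff (γ / n) r T))
      (op_mem (G := G) hn2 ((f - T) - steklovDiff (γ / n) r (f - T)))
    refine (X.norm_add_le _ hfT' _ (X.carrier.add_mem m1 m2)).trans ?_
    gcongr
    refine (X.norm_add_le _ m1 _ m2).trans ?_
    gcongr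
    exact X.norm_sub_le (op_mem hn2 _) (op_mem hn2 _)
  have b4 : (1 + K * C) * X.norm (f - T) < ε / 2 := by
    calc _ < (1 + K * C) * (ε / (2 * (1 + K * C))) := by gcongr
      _ = ε / 2 := by field_simp
  linarith

lemma Spacing.tendsto_norm_sub_op_of_tendsto_discNorm (hG : G.Spacing γ γ') (hγ : 0 < γ)
    (hγ' : 0 < γ') (hA : X.SteklovBounded) (hdense : X.TrigDense) {r s : ℕ} (hr : 1 ≤ r)
    (hs : 1 ≤ s) (h1 : G.A1) (h3 : G.A3 s) (hf : f ∈ X.carrier)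
    (h : Tendsto (fun n : ℕ => G.discNorm n (steklovDiff (γ / n) r f)) atTop (𝓝 0)) :
    Tendsto (fun n : ℕ => X.norm (f - G.op n f)) atTop (𝓝 0) := by
  have l1 := hG.tendsto_norm_sub_op_smooth hγ hγ' hA hdense hr hs h1 h3 hf
  obtain ⟨K, hK, HK⟩ := h1
  have l2 := l1.add (h.const_mul K)
  rw [mul_zero, add_zero] at l2
  refine tendsto_of_tendsto_of_tendsto_of_le_of_le' tendsto_const_nhds l2 ?_ ?_
  · filter_upwards [eventually_ge_atTop 1] with n hn
    exact X.norm_nonneg _ (X.carrier.sub_mem hf (op_mem hn f))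
  · filter_upwards [eventually_ge_atTop 1] with n hn
    have hd := hA.steklovDiff_mem (h := γ / n) (by positivity) r hf
    have e : f - G.op n f = (f - G.op n (f - steklovDiff (γ / n) r f)) -
        G.op n (steklovDiff (γ / n) r f) := by
      rw [op_sub]; abel
    rw [e]
    refine (X.norm_sub_le (X.carrier.sub_mem hf (op_mem hn _)) (op_mem hn _)).trans ?_
    gcongr
    exact HK n hn _ hd

lemma Spacing.tendsto_discNorm_of_tendsto_norm_sub_op (hG : G.Spacing γ γ') (hγ : 0 < γ)
    (hγ' : 0 < γ') (hA : X.SteklovBounded) (hdense : X.TrigDense) {r s : ℕ} (hr : 1 ≤ r)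
    (hs : 1 ≤ s) (h1 : G.A1) (h2 : G.A2) (h3 : G.A3 s) (hf : f ∈ X.carrier)
    (h : Tendsto (fun n : ℕ => X.norm (f - G.op n f)) atTop (𝓝 0)) :
    Tendsto (fun n : ℕ => G.discNorm n (steklovDiff (γ / n) r f)) atTop (𝓝 0) := by
  have l1 := hG.tendsto_norm_sub_op_smooth hγ hγ' hA hdense hr hs h1 h3 hf
  obtain ⟨K, hK, HK⟩ := h2
  have l2 := (l1.add h).const_mul K⁻¹
  rw [add_zero, mul_zero] at l2
  refine tendsto_of_tendsto_of_tendsto_of_le_of_le' tendsto_const_nhds l2 ?_ ?_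
  · filter_upwards [eventually_ge_atTop 1] with n hn
    exact hG.discNorm_nonneg hγ hn _
  · filter_upwards [eventually_ge_atTop 1] with n hn
    have hd := hA.steklovDiff_mem (h := γ / n) (by positivity) r hf
    have e : G.op n (steklovDiff (γ / n) r f) =
        (f - G.op n (f - steklovDiff (γ / n) r f)) - (f - G.op n f) := by
      rw [op_sub]; abel
    rw [inv_mul_eq_div, le_div_iff₀' hK]
    refine (HK n hn _ hd).trans ?_
    rw [e]
    exact X.norm_sub_le (X.carrier.sub_mem hf (op_mem hn _)) (X.carrier.sub_mem hf (op_mem hn _))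

end SamplingScheme

/-! ### A reproducing kernel and its dyadic majorant. -/

section Kernel

lemma integral_fourier (m : ℤ) :
    ∫ t in (-Real.pi)..Real.pi, (fourier m (t : Circ) : ℂ) = if m = 0 then (2 * Real.pi : ℂ) else 0 := by
  split_ifs with hm
  · subst hm
    simp only [fourier_zero, intervalIntegral.integral_const]
    rw [Complex.real_smul, mul_one]
    push_cast
    ring
  · have h1 : ∀ t : ℝ, (fourier m (t : Circ) : ℂ) = Complex.exp ((m * Complex.I : ℂ) * t) := by
      intro t
      rw [fourier_coe_apply]
      congr 1
      have : (Real.pi : ℂ) ≠ 0 := Complex.ofReal_ne_zero.2 Real.pi_ne_zero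
      push_cast
      field_simp
    simp only [h1]
    rw [integral_exp_mul_complex (by simpa using hm), div_eq_zero_iff, sub_eq_zero]
    refine Or.inl (Complex.exp_eq_exp_iff_exists_int.2 ⟨m, ?_⟩)
    push_cast
    ring

/-- The Dirichlet kernel of degree `m`. -/
noncomputable def dirichletKernel (m : ℕ) (t : ℝ) : ℂ :=
  ∑ l ∈ Finset.range (2 * m + 1), fourier ((l : ℤ) - m) (t : Circ)

/-- A kernel of de la Vallée-Poussin type, reproducing `trigPoly n`. -/
noncomputable def reproducingKernel (n : ℕ) (t : ℝ) : ℂ :=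
  (2 * n + 1 : ℂ)⁻¹ * (dirichletKernel n t * dirichletKernel (2 * n) t)

lemma continuous_fourier_coe (k : ℤ) : Continuous fun t : ℝ => (fourier k (t : Circ) : ℂ) :=
  (fourier k).continuous.comp (AddCircle.continuous_mk' _)

lemma continuous_dirichletKernel (m : ℕ) : Continuous (dirichletKernel m) :=
  continuous_finsetSum _ fun _ _ => continuous_fourier_coe _

lemma continuous_reproducingKernel (n : ℕ) : Continuous (reproducingKernel n) :=
  continuous_const.mul ((continuous_dirichletKernel _).mul (continuous_dirichletKernel _))

lemma norm_fourier_apply (k : ℤ) (x : Circ) : ‖(fourier k x : ℂ)‖ = 1 := by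
  rw [fourier_apply]
  exact Circle.norm_coe _

lemma norm_dirichletKernel_le (m : ℕ) (t : ℝ) : ‖dirichletKernel m t‖ ≤ 2 * m + 1 := by
  refine (norm_sum_le _ _).trans_eq ?_
  simp only [norm_fourier_apply]
  simp

lemma dirichletKernel_mul (m : ℕ) (t : ℝ) :
    dirichletKernel m t * (fourier 1 (t : Circ) - 1) =
      fourier ((m : ℤ) + 1) (t : Circ) - fourier (-(m : ℤ)) (t : Circ) := by
  rw [dirichletKernel, Finset.sum_mul]
  have h1 : ∀ l ∈ Finset.range (2 * m + 1),
      (fourier ((l : ℤ) - m) (t : Circ) : ℂ) * (fourier 1 (t : Circ) - 1) =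
        fourier (((l + 1 : ℕ) : ℤ) - m) (t : Circ) - fourier ((l : ℤ) - m) (t : Circ) := by
    intro l _
    rw [mul_sub, mul_one, ← fourier_add]
    congr 3
    push_cast
    ring
  rw [Finset.sum_congr rfl h1,
    Finset.sum_range_sub (fun l : ℕ => (fourier ((l : ℤ) - m) (t : Circ) : ℂ))]
  congr 3
  · push_cast; ring
  · simp

/-- The left factor comes from `|e^{it} - 1| = 2 |sin(t/2)|` and Jordan's inequality. -/
lemma two_div_pi_mul_abs_le {t : ℝ} (ht : |t| ≤ Real.pi) :
    2 / Real.pi * |t| ≤ ‖(fourier 1 (t : Circ) : ℂ) - 1‖ := by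
  have h1 : (fourier 1 (t : Circ) : ℂ) = Complex.exp (Complex.I * t) := by
    rw [fourier_coe_apply]
    congr 1
    have : (Real.pi : ℂ) ≠ 0 := Complex.ofReal_ne_zero.2 Real.pi_ne_zero
    push_cast
    field_simp
  rw [h1, Complex.norm_exp_I_mul_ofReal_sub_one, norm_mul, Real.norm_ofNat, Real.norm_eq_abs]
  have h2 := Real.mul_le_sin (x := |t| / 2) (by positivity) (by linarith)
  have h3 : Real.sin (|t| / 2) ≤ |Real.sin (t / 2)| := by
    rcases abs_cases t with ⟨h, -⟩ | ⟨h, -⟩ <;> rw [h]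
    · exact le_abs_self _
    · rw [neg_div, Real.sin_neg]; exact neg_le_abs _
  calc 2 / Real.pi * |t| = 2 * (2 / Real.pi * (|t| / 2)) := by ring
    _ ≤ _ := by gcongr; exact h2.trans h3

lemma norm_dirichletKernel_mul_abs_le (m : ℕ) {t : ℝ} (ht : |t| ≤ Real.pi) :
    ‖dirichletKernel m t‖ * |t| ≤ Real.pi := by
  have h1 : ‖dirichletKernel m t‖ * ‖(fourier 1 (t : Circ) : ℂ) - 1‖ ≤ 2 := by
    rw [← norm_mul, dirichletKernel_mul]
    refine (norm_sub_le _ _).trans_eq ?_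
    rw [norm_fourier_apply, norm_fourier_apply]
    norm_num
  have h2 := mul_le_mul_of_nonneg_left (two_div_pi_mul_abs_le ht)
    (norm_nonneg (dirichletKernel m t))
  have hpi := Real.pi_pos
  calc ‖dirichletKernel m t‖ * |t|
      = Real.pi / 2 * (‖dirichletKernel m t‖ * (2 / Real.pi * |t|)) := by field_simp
    _ ≤ Real.pi / 2 * 2 := by gcongr; exact h2.trans h1
    _ = Real.pi := by ring

lemma norm_reproducingKernel (n : ℕ) (t : ℝ) : ‖reproducingKernel n t‖ =
    (2 * n + 1 : ℝ)⁻¹ * (‖dirichletKernel n t‖ * ‖dirichletKernel (2 * n) t‖) := by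
  rw [reproducingKernel, norm_mul, norm_mul, norm_inv]
  congr 2
  exact_mod_cast Complex.norm_natCast (2 * n + 1)

lemma norm_reproducingKernel_le {n : ℕ} (hn : 1 ≤ n) (t : ℝ) :
    ‖reproducingKernel n t‖ ≤ 5 * n := by
  have hn' : (1 : ℝ) ≤ n := by exact_mod_cast hn
  rw [norm_reproducingKernel]
  have h1 := norm_dirichletKernel_le n t
  have h2 := norm_dirichletKernel_le (2 * n) t
  push_cast at h2
  calc _ ≤ (2 * n + 1 : ℝ)⁻¹ * ((2 * n + 1) * (2 * (2 * n) + 1)) := by gcongr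
    _ = 4 * n + 1 := by field_simp; ring
    _ ≤ 5 * n := by linarith

/-- Each Dirichlet factor decays like `π/|t|`, so the product decays quadratically; a single
Dirichlet kernel would not suffice for a summable dyadic majorant. -/
lemma norm_reproducingKernel_mul_sq_le {n : ℕ} (hn : 1 ≤ n) {t : ℝ} (ht : |t| ≤ Real.pi) :
    ‖reproducingKernel n t‖ * (|t| * n) ^ 2 ≤ 5 * n := by
  have hn' : (1 : ℝ) ≤ n := by exact_mod_cast hn
  rw [norm_reproducingKernel]
  have h1 := norm_dirichletKernel_mul_abs_le n ht
  have h2 := norm_dirichletKernel_mul_abs_le (2 * n) ht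
  have h3 : Real.pi * Real.pi ≤ 10 := by
    nlinarith [Real.pi_lt_d2, Real.pi_pos]
  calc _ = (2 * n + 1 : ℝ)⁻¹ * ((‖dirichletKernel n t‖ * |t|) *
          (‖dirichletKernel (2 * n) t‖ * |t|)) * n ^ 2 := by ring
    _ ≤ (2 * n + 1 : ℝ)⁻¹ * (Real.pi * Real.pi) * n ^ 2 := by
        gcongr
    _ ≤ (2 * n : ℝ)⁻¹ * 10 * n ^ 2 := by gcongr; linarith
    _ = 5 * n := by field_simp; ring

lemma reproducingKernel_eq (n : ℕ) {k : ℤ} (hk : k ∈ Icc (-(n : ℤ)) n) :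
    ∫ t in (-Real.pi)..Real.pi, (fourier k (t : Circ) : ℂ) * reproducingKernel n t =
      2 * Real.pi := by
  have e : ∀ t : ℝ, (fourier k (t : Circ) : ℂ) * reproducingKernel n t =
      (2 * n + 1 : ℂ)⁻¹ * ∑ l ∈ Finset.range (2 * n + 1), ∑ j ∈ Finset.range (2 * (2 * n) + 1),
        fourier (k + ((l - n) + (j - (2 * n : ℕ)))) (t : Circ) := by
    intro t
    rw [reproducingKernel, dirichletKernel, dirichletKernel, Finset.sum_mul_sum, mul_left_comm,
      Finset.mul_sum]
    simp only [Finset.mul_sum, fourier_add]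
  simp only [e]
  rw [intervalIntegral.integral_const_mul, intervalIntegral.integral_finsetSum
    fun l _ => (continuous_finsetSum _ fun j _ =>
      continuous_fourier_coe _).intervalIntegrable _ _]
  have h1 : ∀ l ∈ Finset.range (2 * n + 1), ∫ t in (-Real.pi)..Real.pi,
      ∑ j ∈ Finset.range (2 * (2 * n) + 1),
        (fourier (k + ((l - n) + (j - (2 * n : ℕ)))) (t : Circ) : ℂ) = 2 * Real.pi := by
    intro l hl
    rw [intervalIntegral.integral_finsetSum
      fun j _ => (continuous_fourier_coe _).intervalIntegrable _ _]
    simp only [integral_fourier]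
    have hl' := Finset.mem_range.1 hl
    obtain ⟨hk1, hk2⟩ := hk
    -- For each `l` exactly one `j` makes the total frequency zero. The bounds `|k| ≤ n` and `0 ≤ l
    -- ≤ 2n` put `3n - k - l` in `[0, 4n]`, which is why the second factor has degree `2n`.
    rw [Finset.sum_eq_single_of_mem (3 * n - k - l).toNat (Finset.mem_range.2 (by omega))]
    · rw [if_pos (by omega)]
    · intro j _ hj
      rw [if_neg (by omega)]
  rw [Finset.sum_congr rfl h1, Finset.sum_const, Finset.card_range, nsmul_eq_mul]
  have : (2 * n + 1 : ℂ) ≠ 0 := by exact_mod_cast Nat.succ_ne_zero (2 * n)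
  push_cast
  field_simp

lemma integral_mul_reproducingKernel {n : ℕ} {T : Circ → ℂ} (hT : T ∈ trigPoly n) (y : Circ) :
    ∫ t in (-Real.pi)..Real.pi, T (y + (t : Circ)) * reproducingKernel n t =
      2 * Real.pi * T y := by
  have hint : ∀ S ∈ trigPoly n, IntervalIntegrable
      (fun t : ℝ => S (y + (t : Circ)) * reproducingKernel n t) volume (-Real.pi) Real.pi :=
    fun S hS => (((continuous_of_mem_trigPoly hS).comp (continuous_const.add
      (AddCircle.continuous_mk' _))).mul (continuous_reproducingKernel n)).intervalIntegrable _ _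
  induction hT using Submodule.span_induction with
  | mem T h =>
    obtain ⟨k, hk, rfl⟩ := h
    have : ∀ t : ℝ, (fourier k (y + (t : Circ)) : ℂ) * reproducingKernel n t =
        fourier k y * (fourier k (t : Circ) * reproducingKernel n t) := by
      intro t
      rw [← mul_assoc]
      congr 1
      simp only [fourier_apply, smul_add, AddCircle.toCircle_add, Circle.coe_mul]
    simp only [this]
    rw [intervalIntegral.integral_const_mul, reproducingKernel_eq n hk, mul_comm]
  | zero => simp
  | add f g hf hg ihf ihg =>
    simp only [Pi.add_apply, add_mul]
    rw [intervalIntegral.integral_add (hint f hf) (hint g hg), ihf, ihg, mul_add]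
  | smul c f hf ihf =>
    simp only [Pi.smul_apply, smul_eq_mul, mul_assoc]
    rw [intervalIntegral.integral_const_mul, ihf]
    ring

lemma norm_reproducingKernel_le_dyadic {n : ℕ} (hn : 1 ≤ n) {t : ℝ} (ht : |t| ≤ Real.pi) :
    ‖reproducingKernel n t‖ ≤ ∑ j ∈ Finset.range (n + 3),
      (Icc (-((2 : ℝ) ^ j / n)) (2 ^ j / n)).indicator (fun _ => 20 * (n : ℝ) / 4 ^ j) t := by
  have hn0 : (0 : ℝ) < n := by positivity
  have hex : |t| * n ≤ (2 : ℝ) ^ (n + 2) := by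
    have h1 : (n : ℝ) ≤ 2 ^ n := by exact_mod_cast (Nat.lt_two_pow_self (n := n)).le
    calc |t| * n ≤ 4 * 2 ^ n := by gcongr; linarith [Real.pi_le_four]
      _ = 2 ^ (n + 2) := by ring
  classical
  have hex' : ∃ j : ℕ, |t| * n ≤ (2 : ℝ) ^ j := ⟨_, hex⟩
  -- For the least such `j`, either `j = 0` and the bound `5n` suffices, or `|t| n > 2^(j-1)` and
  -- quadratic decay gives `5n / 4^(j-1) = 20n / 4^j`.
  set j := Nat.find hex' with hj
  have hj1 : |t| * n ≤ (2 : ℝ) ^ j := Nat.find_spec hex'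
  have hj2 : j ≤ n + 2 := Nat.find_min' hex' hex
  have h2 : ‖reproducingKernel n t‖ ≤ 20 * n / 4 ^ j := by
    rcases Nat.eq_zero_or_pos j with h0 | h0
    · rw [h0, pow_zero, div_one]
      linarith [norm_reproducingKernel_le hn t]
    · obtain ⟨i, hi⟩ := Nat.exists_eq_add_of_le' h0
      have h3 : (2 : ℝ) ^ i < |t| * n := not_le.1 (Nat.find_min hex' (m := i) (by omega))
      have h4 : (4 : ℝ) ^ i ≤ (|t| * n) ^ 2 := by
        calc (4 : ℝ) ^ i = (2 ^ i) ^ 2 := by rw [← pow_mul, mul_comm i, pow_mul]; norm_num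
          _ ≤ _ := by gcongr
      have h5 := (mul_le_mul_of_nonneg_left h4 (norm_nonneg _)).trans
        (norm_reproducingKernel_mul_sq_le hn ht)
      rw [le_div_iff₀ (by positivity), hi, pow_succ]
      linarith
  refine h2.trans ?_
  have hmem : t ∈ Icc (-((2 : ℝ) ^ j / n)) (2 ^ j / n) :=
    abs_le.1 ((le_div_iff₀ hn0).2 hj1)
  have h6 := Finset.single_le_sum (s := Finset.range (n + 3))
    (f := fun j => (Icc (-((2 : ℝ) ^ j / n)) (2 ^ j / n)).indicator
      (fun _ => 20 * (n : ℝ) / 4 ^ j) t)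
    (fun i _ => indicator_nonneg (fun _ _ => by positivity) t)
    (Finset.mem_range.2 (show j < n + 3 by omega))
  simpa only [indicator_of_mem hmem] using h6

/-- Dyadic windows may stick out of `[-π, π]`; nonnegativity allows integrating over the whole
window. -/
lemma integral_indicator_le {u : ℝ → ℝ} (hu : Continuous u) (hu0 : ∀ t, 0 ≤ u t) {a b : ℝ}
    (ha : 0 ≤ a) (hb : 0 ≤ b) :
    ∫ t in (-a)..a, (Icc (-b) b).indicator u t ≤ ∫ t in (-b)..b, u t := by
  rw [intervalIntegral.integral_of_le (by linarith), intervalIntegral.integral_of_le (by linarith),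
    setIntegral_indicator measurableSet_Icc, ← integral_Icc_eq_integral_Ioc]
  exact setIntegral_mono_set (hu.continuousOn.integrableOn_Icc)
    (Eventually.of_forall hu0) (Eventually.of_forall fun _ h => h.2)

/-- A trigonometric polynomial of degree `n` is dominated by dyadic averages of itself. -/
lemma norm_le_sum_integral {n : ℕ} (hn : 1 ≤ n) {T : Circ → ℂ} (hT : T ∈ trigPoly n) (y : Circ) :
    ‖T y‖ ≤ ∑ j ∈ Finset.range (n + 3), 20 * (n : ℝ) / 4 ^ j *
      ∫ t in (-((2 : ℝ) ^ j / n))..(2 ^ j / n), ‖T (y + (t : Circ))‖ := by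
  have hpi := Real.pi_pos
  have hc : Continuous fun t : ℝ => ‖T (y + (t : Circ))‖ :=
    ((continuous_of_mem_trigPoly hT).comp
      (continuous_const.add (AddCircle.continuous_mk' _))).norm
  have hi : ∀ j : ℕ, IntervalIntegrable (fun t : ℝ => 20 * (n : ℝ) / 4 ^ j *
      (Icc (-((2 : ℝ) ^ j / n)) (2 ^ j / n)).indicator (fun t => ‖T (y + (t : Circ))‖) t)
      volume (-Real.pi) Real.pi := fun j => by
    refine IntervalIntegrable.const_mul ?_ _
    rw [intervalIntegrable_iff]
    exact (intervalIntegrable_iff.1 (hc.intervalIntegrable _ _)).indicator measurableSet_Icc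
  have hsum := IntervalIntegrable.sum (Finset.range (n + 3)) fun j _ => hi j
  simp only [Finset.sum_fn] at hsum
  have h1 : 2 * Real.pi * ‖T y‖ ≤
      ∫ t in (-Real.pi)..Real.pi, ‖T (y + (t : Circ))‖ * ‖reproducingKernel n t‖ := by
    have := intervalIntegral.norm_integral_le_integral_norm (μ := volume)
      (f := fun t : ℝ => T (y + (t : Circ)) * reproducingKernel n t) (a := -Real.pi)
      (b := Real.pi) (by linarith)
    rw [integral_mul_reproducingKernel hT] at this
    simpa [abs_of_pos hpi] using this
  have h2 : ∫ t in (-Real.pi)..Real.pi, ‖T (y + (t : Circ))‖ * ‖reproducingKernel n t‖ ≤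
      ∫ t in (-Real.pi)..Real.pi, ∑ j ∈ Finset.range (n + 3), 20 * (n : ℝ) / 4 ^ j *
        (Icc (-((2 : ℝ) ^ j / n)) (2 ^ j / n)).indicator (fun t => ‖T (y + (t : Circ))‖) t := by
    refine intervalIntegral.integral_mono_on (by linarith)
      ((hc.mul (continuous_reproducingKernel n).norm).intervalIntegrable _ _)
      hsum fun t ht => ?_
    refine (mul_le_mul_of_nonneg_left (norm_reproducingKernel_le_dyadic hn (abs_le.2 ht))
      (norm_nonneg _)).trans_eq ?_
    rw [Finset.mul_sum]
    refine Finset.sum_congr rfl fun j _ => ?_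
    by_cases h : t ∈ Icc (-((2 : ℝ) ^ j / n)) (2 ^ j / n)
    · rw [indicator_of_mem h, indicator_of_mem h, mul_comm]
    · rw [indicator_of_notMem h, indicator_of_notMem h, mul_zero, mul_zero]
  rw [intervalIntegral.integral_finsetSum fun j _ => hi j] at h2
  -- The gain of `1/(2π)` from the reproducing formula is discarded.
  have h3 : ‖T y‖ ≤ 2 * Real.pi * ‖T y‖ :=
    le_mul_of_one_le_left (norm_nonneg _) (by linarith [Real.pi_gt_three])
  refine (h3.trans (h1.trans h2)).trans (Finset.sum_le_sum fun j _ => ?_)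
  rw [intervalIntegral.integral_const_mul]
  gcongr
  exact integral_indicator_le hc (fun _ => norm_nonneg _) hpi.le (by positivity)

end Kernel

lemma BanachFunctionLattice.sum_mem_and_norm_le (X : BanachFunctionLattice) {ι : Type*}
    (s : Finset ι) {u : ι → Circ → ℂ} (hu : ∀ i ∈ s, u i ∈ X.carrier) :
    ∑ i ∈ s, u i ∈ X.carrier ∧ X.norm (∑ i ∈ s, u i) ≤ ∑ i ∈ s, X.norm (u i) := by
  classical
  induction s using Finset.induction_on with
  | empty => simpa using X.norm_zero.le
  | insert i s hi ih =>
    obtain ⟨h1, h2⟩ := ih fun j hj => hu j (Finset.mem_insert_of_mem hj)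
    have h3 := hu i (Finset.mem_insert_self i s)
    rw [Finset.sum_insert hi, Finset.sum_insert hi]
    exact ⟨X.carrier.add_mem h3 h1, (X.norm_add_le _ h3 _ h1).trans (by gcongr)⟩

/-! ### The Marcinkiewicz–Zygmund inequality and its use for (ii). -/

namespace SamplingScheme

variable {X : BanachFunctionLattice} {G : SamplingScheme X} {γ γ' : ℝ} {f : Circ → ℂ}

/-- The Marcinkiewicz–Zygmund inequality: the discrete semi-norm of a trigonometric polynomial of
degree at most `n` is controlled by its norm. -/
lemma Spacing.exists_discNorm_trigPoly_le (hG : G.Spacing γ γ') (hγ : 0 < γ) (hγ' : 0 < γ')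
    (hA : X.SteklovBounded) : ∃ C : ℝ, 0 ≤ C ∧ ∀ n, 1 ≤ n → ∀ T ∈ trigPoly n,
      G.discNorm n T ≤ C * X.norm T := by
  obtain ⟨C, hC⟩ := hA
  refine ⟨80 * (1 + γ') * |C|, by positivity, fun n hn T hT => ?_⟩
  have hn0 : (0 : ℝ) < n := by positivity
  have hTX := X.mem_of_mem_trigPoly hT
  have hN := X.norm_nonneg T hTX
  obtain ⟨ha, ha'⟩ := X.abs_mem_and_norm_le hTX
  -- The `j`-th dyadic window around the node, of half-width `2^j/n`, enlarged by `γ'/n` so as to be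
  -- centred at any point of the arc. The weight `c j` turns its Steklov average back into an
  -- integral.
  set H : ℕ → ℝ := fun j => 2 * (2 ^ j + γ') / n with hH
  have hH0 : ∀ j, 0 < H j := fun j => by positivity
  set c : ℕ → ℝ := fun j => 20 * (n : ℝ) / 4 ^ j * H j with hc
  have hc0 : ∀ j, 0 ≤ c j := fun j => mul_nonneg (by positivity) (hH0 j).le
  -- The window grows like `2^j` against the kernel bound `4^(-j)`, so the weights sum to at most
  -- `80 * (1 + γ')`, uniformly in `n`.
  have hc1 : ∀ j, c j ≤ 40 * (1 + γ') * (1 / 2) ^ j := fun j => by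
    have h1 : (1 : ℝ) ≤ 2 ^ j := one_le_pow₀ (by norm_num)
    have h4 : (4 : ℝ) ^ j = 2 ^ j * 2 ^ j := by rw [← mul_pow]; norm_num
    have h2 : c j = 40 * (2 ^ j + γ') / (2 ^ j * 2 ^ j) := by
      simp only [hc, hH, h4]
      field_simp
      ring
    rw [h2, one_div, inv_pow, ← div_eq_mul_inv, div_le_div_iff₀ (by positivity) (by positivity)]
    have : 2 ^ j + γ' ≤ (1 + γ') * 2 ^ j := by nlinarith
    calc 40 * (2 ^ j + γ') * 2 ^ j ≤ 40 * ((1 + γ') * 2 ^ j) * 2 ^ j := by gcongr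
      _ = _ := by ring
  have hS : ∀ j, (fun x => (‖steklov (H j) (fun y => (‖T y‖ : ℂ)) x‖ : ℂ)) ∈ X.carrier ∧
      X.norm (fun x => (‖steklov (H j) (fun y => (‖T y‖ : ℂ)) x‖ : ℂ)) ≤ |C| * X.norm T :=
    fun j => by
      obtain ⟨h1, h2⟩ := hC (H j) (hH0 j) _ ha
      obtain ⟨h3, h4⟩ := X.abs_mem_and_norm_le h1
      refine ⟨h3, h4.trans (h2.trans ?_)⟩
      exact mul_le_mul (le_abs_self C) ha' (X.norm_nonneg _ ha) (abs_nonneg C)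
  obtain ⟨hv, hv'⟩ := X.sum_mem_and_norm_le (Finset.range (n + 3))
    (u := fun j => (c j : ℂ) • fun x => (‖steklov (H j) (fun y => (‖T y‖ : ℂ)) x‖ : ℂ))
    fun j _ => X.carrier.smul_mem _ (hS j).1
  refine (hG.discNorm_le hγ hn hv fun k hk x hx => ?_).trans (hv'.trans ?_)
  · obtain ⟨δ, hδ, he⟩ := hG.exists_node_eq hn hk hx
    have hval : ‖(∑ j ∈ Finset.range (n + 3), (c j : ℂ) • fun x =>
        (‖steklov (H j) (fun y => (‖T y‖ : ℂ)) x‖ : ℂ)) x‖ =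
        ∑ j ∈ Finset.range (n + 3), c j * ‖steklov (H j) (fun y => (‖T y‖ : ℂ)) x‖ := by
      simp only [Finset.sum_apply, Pi.smul_apply, smul_eq_mul, ← Complex.ofReal_mul,
        ← Complex.ofReal_sum, Complex.norm_real]
      exact Real.norm_of_nonneg
        (Finset.sum_nonneg fun j _ => mul_nonneg (hc0 j) (norm_nonneg _))
    rw [hval, he]
    refine (norm_le_sum_integral hn hT _).trans (Finset.sum_le_sum fun j _ => ?_)
    rw [norm_steklov_abs T (hH0 j), hc, mul_assoc, ← mul_assoc (H j),
      mul_one_div_cancel (hH0 j).ne', one_mul]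
    refine mul_le_mul_of_nonneg_left ?_ (by positivity)
    refine integral_translate_le (X.integrable hTX).norm (fun _ => norm_nonneg _) x
      (by positivity) ?_
    have : H j / 2 = 2 ^ j / n + γ' / n := by simp only [hH]; field_simp
    linarith
  · calc _ ≤ ∑ j ∈ Finset.range (n + 3), 40 * (1 + γ') * (1 / 2 : ℝ) ^ j * (|C| * X.norm T) := by
          refine Finset.sum_le_sum fun j _ => ?_
          rw [X.norm_smul _ _ (hS j).1, Complex.norm_real, Real.norm_of_nonneg (hc0 j)]
          exact mul_le_mul (hc1 j) (hS j).2 (X.norm_nonneg _ (hS j).1) (by positivity)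
      _ = 40 * (1 + γ') * (∑ j ∈ Finset.range (n + 3), (1 / 2 : ℝ) ^ j) * (|C| * X.norm T) := by
          rw [← Finset.sum_mul, ← Finset.mul_sum]
      _ ≤ 40 * (1 + γ') * 2 * (|C| * X.norm T) := by
          gcongr
          exact sum_geometric_two_le _
      _ = _ := by ring

/-- If the `G_n` take values in `trigPoly n`, then convergence in `X` makes `G_n f` close to the
smoothed function `f - (I - A_{γ/n})^r f` in the discrete semi-norms. -/
lemma Spacing.tendsto_discNorm_smooth_sub_op (hG : G.Spacing γ γ') (hγ : 0 < γ) (hγ' : 0 < γ')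
    (hA : X.SteklovBounded) (hdense : X.TrigDense) {r : ℕ} (hr : 1 ≤ r)
    (hM : G.MapsToTrig) (hf : f ∈ X.carrier)
    (h : Tendsto (fun n : ℕ => X.norm (f - G.op n f)) atTop (𝓝 0)) :
    Tendsto (fun n : ℕ => G.discNorm n (f - steklovDiff (γ / n) r f - G.op n f))
      atTop (𝓝 0) := by
  obtain ⟨C, hC, HC⟩ := hG.exists_discNorm_sub_steklovDiff_le hγ hγ' hA r
  obtain ⟨C', hC', HC'⟩ := hG.exists_discNorm_trigPoly_le hγ hγ' hA
  refine Metric.tendsto_atTop.2 fun ε hε => ?_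
  obtain ⟨m, T, hT, hfT⟩ := hdense f hf (ε / (2 * (1 + C + C'))) (by positivity)
  have hTX := X.mem_of_mem_trigPoly hT
  have l1 := (hG.tendsto_discNorm_steklovDiff_of_continuous hγ hr
    (continuous_of_mem_trigPoly hT)).add (h.const_mul C')
  rw [mul_zero, add_zero] at l1
  obtain ⟨N, hN⟩ := eventually_atTop.1 ((l1.eventually (gt_mem_nhds (half_pos hε))).and
    ((eventually_ge_atTop 1).and (eventually_ge_atTop m)))
  refine ⟨N, fun n hn => ?_⟩
  obtain ⟨hn1, hn2, hn3⟩ := hN n hn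
  have hh : 0 < γ / n := by positivity
  have hfT' := X.carrier.sub_mem hf hTX
  have hfG := X.carrier.sub_mem hf (op_mem (G := G) hn2 f)
  rw [Real.dist_0_eq_abs, abs_of_nonneg (hG.discNorm_nonneg hγ hn2 _)]
  -- The first bracket is controlled by `X.norm (f - T)`, the second difference tends to zero, and
  -- `T - G.op n f` has degree at most `n` once `m ≤ n`, so its discrete semi-norm is controlled by
  -- its norm.
  have e : f - steklovDiff (γ / n) r f - G.op n f =
      (((f - T) - steklovDiff (γ / n) r (f - T)) - steklovDiff (γ / n) r T) +
        (T - G.op n f) := by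
    rw [hA.steklovDiff_sub hh r hf hTX]
    abel
  have b1 := HC n hn2 _ hfT'
  have b2 := HC' n hn2 _ ((trigPoly n).sub_mem (trigPoly_mono hn3 hT) (hM n hn2 f hf))
  have b3 : X.norm (T - G.op n f) ≤ X.norm (f - G.op n f) + X.norm (f - T) := by
    rw [show T - G.op n f = (f - G.op n f) - (f - T) by abel]
    exact X.norm_sub_le hfG hfT'
  have b4 := mul_le_mul_of_nonneg_left b3 hC'
  have b5 := hG.discNorm_add_le hγ hn2
    (((f - T) - steklovDiff (γ / n) r (f - T)) - steklovDiff (γ / n) r T) (T - G.op n f)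
  have b6 := hG.discNorm_sub_le hγ hn2
    ((f - T) - steklovDiff (γ / n) r (f - T)) (steklovDiff (γ / n) r T)
  have b7 : (1 + C + C') * X.norm (f - T) < ε / 2 := by
    calc _ < (1 + C + C') * (ε / (2 * (1 + C + C'))) := by gcongr
      _ = ε / 2 := by field_simp
  have b8 := X.norm_nonneg _ hfT'
  rw [e]
  linarith

end SamplingScheme

end SteklovSampling

/-! ### The two equivalences. -/

theorem corollary3p1 (X : SteklovSampling.BanachFunctionLattice)
    (hA : X.SteklovBounded) (hdense : X.TrigDense)
    (G : SteklovSampling.SamplingScheme X) (γ γ' : ℝ) (hγ : 0 < γ) (hγ' : 0 < γ')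
    (hG : G.Spacing γ γ') (r s : ℕ) (hr : 1 ≤ r) (hs : 1 ≤ s)
    (f : SteklovSampling.Circ → ℂ) (hf : AEMeasurable f SteklovSampling.μT)
    (hfb : ∃ M : ℝ, ∀ x, ‖f x‖ ≤ M) :
    (G.A1 → G.A2 → G.A3 s →
      (Tendsto (fun n : ℕ => X.norm (f - G.op n f)) atTop (𝓝 0) ↔
        Tendsto (fun n : ℕ => G.discNorm n (SteklovSampling.steklovDiff (γ / n) r f))
          atTop (𝓝 0))) ∧
    (G.MapsToTrig → G.A1 → G.A3 s →
      (Tendsto (fun n : ℕ => X.norm (f - G.op n f) + G.discNorm n (f - G.op n f))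
          atTop (𝓝 0) ↔
        Tendsto (fun n : ℕ => G.discNorm n (SteklovSampling.steklovDiff (γ / n) r f))
          atTop (𝓝 0))) := by
  obtain ⟨M, hM⟩ := hfb
  have hfX := (X.mem_and_norm_le_of_bound hf hM).1
  refine ⟨fun h1 h2 h3 =>
    ⟨hG.tendsto_discNorm_of_tendsto_norm_sub_op hγ hγ' hA hdense hr hs h1 h2 h3 hfX,
      hG.tendsto_norm_sub_op_of_tendsto_discNorm hγ hγ' hA hdense hr hs h1 h3 hfX⟩,
    fun hT h1 h3 => ⟨fun h => ?_, fun h => ?_⟩⟩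
  · have l1 : Tendsto (fun n : ℕ => X.norm (f - G.op n f)) atTop (𝓝 0) := by
      refine tendsto_of_tendsto_of_tendsto_of_le_of_le' tendsto_const_nhds h ?_ ?_
      · filter_upwards [eventually_ge_atTop 1] with n hn
        exact X.norm_nonneg _
          (X.carrier.sub_mem hfX (SteklovSampling.SamplingScheme.op_mem hn f))
      · filter_upwards [eventually_ge_atTop 1] with n hn
        exact le_add_of_nonneg_right (hG.discNorm_nonneg hγ hn _)
    have l2 := h.add (hG.tendsto_discNorm_smooth_sub_op hγ hγ' hA hdense hr hT hfX l1)
    rw [add_zero] at l2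
    refine tendsto_of_tendsto_of_tendsto_of_le_of_le' tendsto_const_nhds l2 ?_ ?_
    · filter_upwards [eventually_ge_atTop 1] with n hn
      exact hG.discNorm_nonneg hγ hn _
    · filter_upwards [eventually_ge_atTop 1] with n hn
      have e : SteklovSampling.steklovDiff (γ / n) r f =
          (f - G.op n f) - (f - SteklovSampling.steklovDiff (γ / n) r f - G.op n f) := by abel
      have b1 := hG.discNorm_sub_le hγ hn (f - G.op n f)
        (f - SteklovSampling.steklovDiff (γ / n) r f - G.op n f)
      rw [← e] at b1
      have b2 := X.norm_nonneg _
        (X.carrier.sub_mem hfX (SteklovSampling.SamplingScheme.op_mem (G := G) hn f))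
      linarith
  · have l1 := hG.tendsto_norm_sub_op_of_tendsto_discNorm hγ hγ' hA hdense hr hs h1 h3 hfX h
    have l2 := l1.add ((hG.tendsto_discNorm_smooth_sub_op hγ hγ' hA hdense hr hT hfX l1).add h)
    rw [add_zero, add_zero] at l2
    refine tendsto_of_tendsto_of_tendsto_of_le_of_le' tendsto_const_nhds l2 ?_ ?_
    · filter_upwards [eventually_ge_atTop 1] with n hn
      exact add_nonneg (X.norm_nonneg _ (X.carrier.sub_mem hfX
        (SteklovSampling.SamplingScheme.op_mem hn f))) (hG.discNorm_nonneg hγ hn _)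
    · filter_upwards [eventually_ge_atTop 1] with n hn
      have b1 := hG.discNorm_add_le hγ hn
        (f - SteklovSampling.steklovDiff (γ / n) r f - G.op n f)
        (SteklovSampling.steklovDiff (γ / n) r f)
      rw [show (f - SteklovSampling.steklovDiff (γ / n) r f - G.op n f) +
        SteklovSampling.steklovDiff (γ / n) r f = f - G.op n f by abel] at b1
      gcongr
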